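/- Let $R$ be a commutative artinian ring, let $\Lambda$ be an artin $R$-algebra (an $R$-algebra that is finitely generated as an $R$-module), let $\mathrm{mod}\,\Lambda$ be the category of finitely generated right $\Lambda$-modules, and let $\mathrm{prj}\,\Lambda$ be its full subcategory of projective modules. Let $\mathcal X$ be a full subcategory of $\mathrm{mod}\,\Lambda$ that contains $\mathrm{prj}\,\Lambda$ and is contravariantly finite, i.e. for every $M\in\mathrm{mod}\,\Lambda$ there is a morphism $X_0\to M$ with $X_0\in\mathcal X$ through which every morphism $X\to M$ with $X\in\mathcal X$ factors. Let $\mathrm{mod}\,\mathcal X$ be the (abelian) category of finitely presented right $\mathcal X$-modules, i.e. of additive functors $F:\mathcal X^{\mathrm{op}}\to\mathcal Ab$ that admit an exact sequence $(-,X_1)\to(-,X_0)\to F\to 0$ with $X_0,X_1\in\mathcal X$. Let $e:\mathrm{mod}\,\mathcal X\to\mathrm{mod}\,\Lambda$ be the exact functor determined by $e(F)=\mathrm{Coker}(X_1\xrightarrow{d}X_0)$ for a presentation $(-,X_1)\xrightarrow{(-,d)}(-,X_0)\to F\to 0$ (on morphisms, $e$ is induced by lifts to the presentations), and let $\mathrm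 D^b_e:\mathrm D^b(\mathrm{mod}\,\mathcal X)\to\mathrm D^b(\mathrm{mod}\,\Lambda)$ be the functor obtained by applying $e$ termwise. Let $\mathrm K^b_{e_\lambda}$ be the functor that sends a complex $\mathbf P\in\mathrm K^b(\mathrm{prj}\,\Lambda)$ to the bounded complex $(-,\mathbf P)$ over $\mathrm{mod}\,\mathcal X$ obtained by applying $P\mapsto(-,P)|_{\mathcal X}$ termwise, regarded as an object of $\mathrm D^b(\mathrm{mod}\,\mathcal X)$. Then for all $\mathbf P\in\mathrm K^b(\mathrm{prj}\,\Lambda)$ and $\mathbf F\in\mathrm D^b(\mathrm{mod}\,\mathcal X)$ there is an isomorphism of abelian groups $$\mathrm D^b(\mathrm{mod}\,\mathcal X)\bigl(\mathrm K^b_{e_\lambda}(\mathbf P),\mathbf F\bigr)\;\cong\;\mathrm D^b(\mathrm{mod}\,\Lambda)\bigl(\mathbf P,\mathrm D^b_e(\mathbf F)\bigr),$$ natural in $\mathbf P\in\mathrm K^b(\mathrm{prj}\,\Lambda)$ and in $\mathbf F\in\mathrm D^b(\mathrm{mod}\,\mathcal X)$. That is, $\mathrm K^b_{e_\lambda}$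 is left adjoint to $\mathrm D^b_e$ on $\mathrm K^b(\mathrm{prj}\,\Lambda)$. -/

import Mathlib

universe w w₁ w₂ v u

noncomputable section

open CategoryTheory Limits Opposite

set_option linter.unusedSectionVars false

namespace RelativeAuslander

section FunctorCategory

variable {A : Type u} [Category.{v} A] [Preadditive A] (X : ObjectProperty A)

/-- `p : X₀ ⟶ M` is a right `X`-approximation of `M`. -/
structure IsRightApprox {X₀ M : A} (p : X₀ ⟶ M) : Prop where
  mem : X X₀
  lift : ∀ ⦃T : A⦄, X T → ∀ f : T ⟶ M, ∃ g : T ⟶ X₀, g ≫ p = f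

/-- `X` is contravariantly finite: every object has a right `X`-approximation. -/
class ContravariantlyFinite : Prop where
  exists_approx : ∀ M : A, ∃ (X₀ : A) (p : X₀ ⟶ M), IsRightApprox X p

/-- `X` contains all projective objects. -/
class ContainsProjectives : Prop where
  mem_of_projective : ∀ P : A, Projective P → X P

/-- The restricted Yoneda functor `M ↦ (-, M)|_X`. -/
def restrictedYoneda : A ⥤ (X.FullSubcategoryᵒᵖ ⥤ AddCommGrpCat.{v}) where
  obj M :=
    { obj := fun T => AddCommGrpCat.of (T.unop.obj ⟶ M)
      map := fun f => AddCommGrpCat.ofHom (Preadditive.leftComp M f.unop.hom)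
      map_id := fun T => by ext t; simp [Preadditive.leftComp]
      map_comp := fun f g => by ext t; simp [Preadditive.leftComp] }
  map m :=
    { app := fun T => AddCommGrpCat.ofHom (Preadditive.rightComp T.unop.obj m)
      naturality := fun T T' f => by
        ext t; simp [Preadditive.leftComp, Preadditive.rightComp] }
  map_id M := by ext T t; simp [Preadditive.rightComp]
  map_comp f g := by ext T t; simp [Preadditive.rightComp]

instance : (restrictedYoneda X).Additive where
  map_add := by intros; ext T t; exact Preadditive.comp_add _ _ _ _ _ _

/-- Finitely presented right `X`-modules: additive functors `F : Xᵒᵖ ⥤ Ab` such that there is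
an exact sequence `(-, X₁) ⟶ (-, X₀) ⟶ F ⟶ 0` with `X₁, X₀` in `X`. (By fullness and the
Yoneda lemma a morphism `(-, X₁) ⟶ (-, X₀)` is `(-, d)` for a morphism `d : X₁ ⟶ X₀`.) -/
def isFinPres : ObjectProperty (X.FullSubcategoryᵒᵖ ⥤ AddCommGrpCat.{v}) := fun F =>
  F.Additive ∧
    ∃ (X₁ X₀ : X.FullSubcategory) (d : X₁ ⟶ X₀) (ε : (restrictedYoneda X).obj X₀.obj ⟶ F)
      (w : (restrictedYoneda X).map d.hom ≫ ε = 0),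
      (ShortComplex.mk ((restrictedYoneda X).map d.hom) ε w).Exact ∧ Epi ε

/-- `mod X`, the category of finitely presented right `X`-modules. -/
abbrev FinPresMod := (isFinPres X).FullSubcategory

variable {X}

/-- Objectwise form of the exactness of `(-, A₁) ⟶ (-, B) ⟶ F ⟶ 0`. -/
structure IsPres {F : X.FullSubcategoryᵒᵖ ⥤ AddCommGrpCat.{v}} {A₁ B : A} (a : A₁ ⟶ B)
    (ε : (restrictedYoneda X).obj B ⟶ F) : Prop where
  surj : ∀ (T : X.FullSubcategory) (z : F.obj (op T)),
    ∃ t : T.obj ⟶ B, (ε.app (op T)).hom t = z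
  ker : ∀ (T : X.FullSubcategory) (t : T.obj ⟶ B),
    (ε.app (op T)).hom t = 0 ↔ ∃ s : T.obj ⟶ A₁, s ≫ a = t

lemma exact_iff_app (S : ShortComplex (X.FullSubcategoryᵒᵖ ⥤ AddCommGrpCat.{v})) :
    S.Exact ↔ ∀ T, (S.map ((evaluation _ _).obj T)).Exact := by
  refine ⟨fun h T => h.map _, fun h => ?_⟩
  rw [S.exact_iff_isZero_homology]
  rw [Functor.isZero_iff]
  intro T
  exact ((ShortComplex.exact_iff_isZero_homology _).1 (h T)).of_iso
    (S.mapHomologyIso ((evaluation _ _).obj T)).symm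

lemma isPres_iff {F : X.FullSubcategoryᵒᵖ ⥤ AddCommGrpCat.{v}} {A₁ B : A} (a : A₁ ⟶ B)
    (ε : (restrictedYoneda X).obj B ⟶ F) :
    IsPres a ε ↔ ∃ w : (restrictedYoneda X).map a ≫ ε = 0,
      (ShortComplex.mk ((restrictedYoneda X).map a) ε w).Exact ∧ Epi ε := by
  constructor
  · intro h
    refine ⟨?_, ?_, ?_⟩
    · ext T t
      exact (h.ker T.unop (t ≫ a)).2 ⟨t, rfl⟩
    · rw [exact_iff_app]
      intro T
      rw [ShortComplex.ab_exact_iff]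
      intro t ht
      exact (h.ker T.unop t).1 ht
    · rw [NatTrans.epi_iff_epi_app]
      intro T
      rw [AddCommGrpCat.epi_iff_surjective]
      exact h.surj T.unop
  · rintro ⟨w, h, h'⟩
    refine ⟨fun T z => ?_, fun T t => ⟨fun ht => ?_, ?_⟩⟩
    · rw [NatTrans.epi_iff_epi_app] at h'
      exact (AddCommGrpCat.epi_iff_surjective _).1 (h' (op T)) z
    · exact (ShortComplex.ab_exact_iff _).1 ((exact_iff_app _).1 h (op T)) t ht
    · rintro ⟨s, rfl⟩
      have := congr_arg (fun f => (f.app (op T)).hom s) w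
      exact this

lemma app_comp {F : X.FullSubcategoryᵒᵖ ⥤ AddCommGrpCat.{v}} {B : A}
    (ε : (restrictedYoneda X).obj B ⟶ F) {T T' : X.FullSubcategory} (f : T' ⟶ T)
    (t : T.obj ⟶ B) :
    (ε.app (op T')).hom (f.hom ≫ t : T'.obj ⟶ B) = (F.map f.op).hom ((ε.app (op T)).hom t) :=
  congr_arg (fun g => g.hom t) (ε.naturality f.op)

lemma map_comp_app {F : X.FullSubcategoryᵒᵖ ⥤ AddCommGrpCat.{v}} {B C : A}
    (ε : (restrictedYoneda X).obj B ⟶ F) (m : C ⟶ B) {T : X.FullSubcategory} (t : T.obj ⟶ C) :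
    (((restrictedYoneda X).map m ≫ ε).app (op T)).hom t
      = (ε.app (op T)).hom (t ≫ m : T.obj ⟶ B) := rfl

lemma app_add {F : X.FullSubcategoryᵒᵖ ⥤ AddCommGrpCat.{v}} {B : A}
    (ε : (restrictedYoneda X).obj B ⟶ F) {T : X.FullSubcategory} (t t' : T.obj ⟶ B) :
    (ε.app (op T)).hom (t + t' : T.obj ⟶ B)
      = (ε.app (op T)).hom t + (ε.app (op T)).hom t' := map_add _ t t'

lemma app_sub {F : X.FullSubcategoryᵒᵖ ⥤ AddCommGrpCat.{v}} {B : A}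
    (ε : (restrictedYoneda X).obj B ⟶ F) {T : X.FullSubcategory} (t t' : T.obj ⟶ B) :
    (ε.app (op T)).hom (t - t' : T.obj ⟶ B)
      = (ε.app (op T)).hom t - (ε.app (op T)).hom t' := map_sub _ t t'

lemma IsPres.additive {F : X.FullSubcategoryᵒᵖ ⥤ AddCommGrpCat.{v}} {A₁ B : A} {a : A₁ ⟶ B}
    {ε : (restrictedYoneda X).obj B ⟶ F} (h : IsPres a ε) : F.Additive where
  map_add {T T' f g} := by
    ext z
    obtain ⟨t, rfl⟩ := h.surj T.unop z
    have h1 := app_comp ε f.unop t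
    have h2 := app_comp ε g.unop t
    have h3 := app_comp ε (f + g).unop t
    have h4 : (f + g).unop.hom ≫ t = f.unop.hom ≫ t + g.unop.hom ≫ t := by
      rw [← Preadditive.add_comp]; rfl
    rw [h4, app_add, h1, h2] at h3
    exact h3.symm

/-- A morphism of functors lifts along presentations. -/
lemma exists_lift {F G : X.FullSubcategoryᵒᵖ ⥤ AddCommGrpCat.{v}} {B' : A}
    {X₀ : X.FullSubcategory} (ε : (restrictedYoneda X).obj X₀.obj ⟶ F)
    {A' : A} {a' : A' ⟶ B'} {ε' : (restrictedYoneda X).obj B' ⟶ G} (h' : IsPres a' ε')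
    (f : F ⟶ G) :
    ∃ l : X₀.obj ⟶ B', ∀ (T : X.FullSubcategory) (t : T.obj ⟶ X₀.obj),
      (ε'.app (op T)).hom (t ≫ l : T.obj ⟶ B') = (f.app (op T)).hom ((ε.app (op T)).hom t) := by
  obtain ⟨l, hl⟩ := h'.surj X₀ ((f.app (op X₀)).hom ((ε.app (op X₀)).hom (𝟙 X₀.obj)))
  refine ⟨l, fun T t => ?_⟩
  have h1 := app_comp ε' (ObjectProperty.homMk t : T ⟶ X₀) l
  have h2 := app_comp (ε ≫ f) (ObjectProperty.homMk t : T ⟶ X₀) (𝟙 X₀.obj)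
  rw [hl] at h1
  refine h1.trans (h2.symm.trans ?_)
  simp
  rfl

end FunctorCategory

section AbelianStructure

open ZeroObject

variable {A : Type u} [Category.{v} A] [Abelian A] {X : ObjectProperty A}

lemma IsPres.isFinPres [ContravariantlyFinite X]
    {F : X.FullSubcategoryᵒᵖ ⥤ AddCommGrpCat.{v}} {A₁ B : A} {a : A₁ ⟶ B}
    {ε : (restrictedYoneda X).obj B ⟶ F} (h : IsPres a ε) : isFinPres X F := by
  obtain ⟨Z, p, hp⟩ := ContravariantlyFinite.exists_approx (X := X) B
  obtain ⟨Z', p', hp'⟩ := ContravariantlyFinite.exists_approx (X := X) (pullback a p)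
  refine ⟨h.additive, ⟨Z', hp'.mem⟩, ⟨Z, hp.mem⟩,
    ObjectProperty.homMk (p' ≫ pullback.snd a p), (restrictedYoneda X).map p ≫ ε,
    (isPres_iff _ _).1 ⟨fun T z => ?_, fun T t => ?_⟩⟩
  · obtain ⟨t, rfl⟩ := h.surj T z
    obtain ⟨g, rfl⟩ := hp.lift T.property t
    exact ⟨g, rfl⟩
  · refine (h.ker T (t ≫ p)).trans ⟨?_, ?_⟩
    · rintro ⟨s, hs⟩
      obtain ⟨g, hg⟩ := hp'.lift T.property (pullback.lift s t hs)
      refine ⟨g, ?_⟩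
      change g ≫ p' ≫ pullback.snd a p = t
      rw [reassoc_of% hg]
      exact pullback.lift_snd _ _ _
    · rintro ⟨s, rfl⟩
      exact ⟨s ≫ p' ≫ pullback.fst a p, by simp [pullback.condition]⟩

/-- Presentations `(-, X₁) ⟶ (-, X₀) ⟶ F ⟶ 0` of a finitely presented module `F`. -/
structure Presentation (F : FinPresMod X) where
  X₁ : X.FullSubcategory
  X₀ : X.FullSubcategory
  d : X₁ ⟶ X₀
  ε : (restrictedYoneda X).obj X₀.obj ⟶ F.obj
  isPres : IsPres d.hom ε

lemma exists_isPres {F : X.FullSubcategoryᵒᵖ ⥤ AddCommGrpCat.{v}} (hF : isFinPres X F) :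
    ∃ (X₁ X₀ : X.FullSubcategory) (d : X₁ ⟶ X₀) (ε : (restrictedYoneda X).obj X₀.obj ⟶ F),
      IsPres d.hom ε := by
  obtain ⟨-, X₁, X₀, d, ε, h⟩ := hF
  exact ⟨X₁, X₀, d, ε, (isPres_iff _ _).2 h⟩

lemma nonempty_presentation (F : FinPresMod X) : Nonempty (Presentation F) := by
  obtain ⟨X₁, X₀, d, ε, h⟩ := exists_isPres F.property
  exact ⟨⟨X₁, X₀, d, ε, h⟩⟩

variable [ContravariantlyFinite X]

instance : (isFinPres X).IsClosedUnderIsomorphisms where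
  of_iso := by
    intro F G e hF
    obtain ⟨X₁, X₀, d, ε, h⟩ := exists_isPres hF
    have hinj : ∀ (T : X.FullSubcategory), Function.Bijective (e.hom.app (op T)).hom := fun T =>
      ConcreteCategory.bijective_of_isIso (e.hom.app (op T))
    refine IsPres.isFinPres (a := d.hom) (ε := ε ≫ e.hom) ⟨fun T z => ?_, fun T t => ?_⟩
    · obtain ⟨y, rfl⟩ := (hinj T).2 z
      obtain ⟨t, rfl⟩ := h.surj T y
      exact ⟨t, rfl⟩
    · rw [← h.ker]
      exact map_eq_zero_iff (e.hom.app (op T)).hom (hinj T).1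

instance : (isFinPres X).ContainsZero where
  exists_zero := by
    refine ⟨(restrictedYoneda X).obj 0, Functor.map_isZero _ (isZero_zero A),
      IsPres.isFinPres (a := (0 : (0 : A) ⟶ 0)) (ε := 𝟙 _) ⟨fun T z => ⟨z, rfl⟩, fun T t => ?_⟩⟩
    exact ⟨fun _ => ⟨0, (isZero_zero A).eq_of_tgt _ _⟩, fun _ => (isZero_zero A).eq_of_tgt _ _⟩

instance : (isFinPres X).IsClosedUnderKernels where
  kernels_le := by
    rintro K hK
    obtain ⟨f, k, hk, hF, hG⟩ := hK
    rename_i F G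
    obtain ⟨X₁, X₀, d, ε, h⟩ := exists_isPres hF
    obtain ⟨X₁', X₀', d', ε', h'⟩ := exists_isPres hG
    obtain ⟨l, hl⟩ := exists_lift ε h' f
    have hex := (ShortComplex.mk k.ι f k.condition).exact_of_f_is_kernel
      (IsLimit.ofIsoLimit hk (Fork.ext (Iso.refl _)))
    have hm : Mono k.ι := Fork.IsLimit.mono hk
    have hinj : ∀ (T : X.FullSubcategory), Function.Injective (k.ι.app (op T)).hom := fun T =>
      (AddCommGrpCat.mono_iff_injective _).1 ((NatTrans.mono_iff_mono_app _).1 hm (op T))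
    have hex' : ∀ (T : X.FullSubcategory) (z : F.obj (op T)), (f.app (op T)).hom z = 0 →
        ∃ y, (k.ι.app (op T)).hom y = z := fun T z hz =>
      (ShortComplex.ab_exact_iff _).1 ((exact_iff_app _).1 hex (op T)) z hz
    have hw : ((restrictedYoneda X).map (pullback.fst l d'.hom) ≫ ε) ≫ f = 0 := by
      ext T t
      refine (hl T.unop (t ≫ pullback.fst l d'.hom)).symm.trans ?_
      refine (h'.ker T.unop _).2 ⟨t ≫ pullback.snd l d'.hom, ?_⟩
      have h3 := t ≫= (pullback.condition (f := l) (g := d'.hom))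
      exact (Category.assoc _ _ _).trans (h3.symm.trans (Category.assoc _ _ _).symm)
    let ρ : (restrictedYoneda X).obj (pullback l d'.hom) ⟶ k.pt := hk.lift (KernelFork.ofι _ hw)
    have hρ : ρ ≫ k.ι = (restrictedYoneda X).map (pullback.fst l d'.hom) ≫ ε :=
      hk.fac (KernelFork.ofι _ hw) WalkingParallelPair.zero
    have hρ' : ∀ (T : X.FullSubcategory) (t : T.obj ⟶ pullback l d'.hom),
        (k.ι.app (op T)).hom ((ρ.app (op T)).hom t)
          = (ε.app (op T)).hom (t ≫ pullback.fst l d'.hom : T.obj ⟶ _) := fun T t =>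
      congr_arg (fun g => (g.app (op T)).hom t) hρ
    refine IsPres.isFinPres (a := pullback.snd d.hom (pullback.fst l d'.hom)) (ε := ρ)
      ⟨fun T z => ?_, fun T t => ?_⟩
    · obtain ⟨t, ht⟩ := h.surj T ((k.ι.app (op T)).hom z)
      have h0 : (ε'.app (op T)).hom (t ≫ l : T.obj ⟶ _) = 0 := by
        rw [hl, ht]
        exact congr_arg (fun g => (g.app (op T)).hom z) k.condition
      obtain ⟨s, hs⟩ := (h'.ker T _).1 h0
      refine ⟨pullback.lift t s hs.symm, hinj T ?_⟩
      rw [hρ', ← ht]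
      exact congr_arg (ε.app (op T)).hom (pullback.lift_fst _ _ _)
    · rw [← map_eq_zero_iff (k.ι.app (op T)).hom (hinj T), hρ', h.ker]
      constructor
      · rintro ⟨s, hs⟩
        exact ⟨pullback.lift s t hs, pullback.lift_snd _ _ _⟩
      · rintro ⟨s, rfl⟩
        refine ⟨s ≫ pullback.fst _ _, ?_⟩
        have h3 := s ≫= (pullback.condition (f := d.hom) (g := pullback.fst l d'.hom))
        exact (Category.assoc _ _ _).trans (h3.trans (Category.assoc _ _ _).symm)

instance : (isFinPres X).IsClosedUnderCokernels where
  cokernels_le := by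
    rintro K hK
    obtain ⟨f, k, hk, hF, hG⟩ := hK
    rename_i F G
    obtain ⟨X₁, X₀, d, ε, h⟩ := exists_isPres hF
    obtain ⟨X₁', X₀', d', ε', h'⟩ := exists_isPres hG
    obtain ⟨l, hl⟩ := exists_lift ε h' f
    have hex := (ShortComplex.mk f k.π k.condition).exact_of_g_is_cokernel
      (IsColimit.ofIsoColimit hk (Cofork.ext (Iso.refl _)))
    have hm : Epi k.π := Cofork.IsColimit.epi hk
    have hsurj : ∀ (T : X.FullSubcategory), Function.Surjective (k.π.app (op T)).hom := fun T =>
      (AddCommGrpCat.epi_iff_surjective _).1 ((NatTrans.epi_iff_epi_app _).1 hm (op T))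
    have hex' : ∀ (T : X.FullSubcategory) (z : G.obj (op T)), (k.π.app (op T)).hom z = 0 →
        ∃ y, (f.app (op T)).hom y = z := fun T z hz =>
      (ShortComplex.ab_exact_iff _).1 ((exact_iff_app _).1 hex (op T)) z hz
    have hz : ∀ (T : X.FullSubcategory) (y : F.obj (op T)),
        (k.π.app (op T)).hom ((f.app (op T)).hom y) = 0 := fun T y =>
      congr_arg (fun g => (g.app (op T)).hom y) k.condition
    refine IsPres.isFinPres (a := biprod.desc d'.hom l) (ε := ε' ≫ k.π)
      ⟨fun T z => ?_, fun T t => ?_⟩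
    · obtain ⟨y, rfl⟩ := hsurj T z
      obtain ⟨t, rfl⟩ := h'.surj T y
      exact ⟨t, rfl⟩
    · change (k.π.app (op T)).hom ((ε'.app (op T)).hom t) = 0 ↔ _
      constructor
      · intro h0
        obtain ⟨y, hy⟩ := hex' T _ h0
        obtain ⟨t', rfl⟩ := h.surj T y
        rw [← hl, eq_comm, ← sub_eq_zero, ← app_sub, h'.ker] at hy
        obtain ⟨s, hs⟩ := hy
        exact ⟨biprod.lift s t', by simp [hs]⟩
      · rintro ⟨s, rfl⟩
        have h1 : s ≫ biprod.desc d'.hom l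
            = (s ≫ biprod.fst) ≫ d'.hom + (s ≫ biprod.snd) ≫ l := by
          rw [biprod.desc_eq]; simp
        rw [h1, app_add, hl, map_add, hz, (h'.ker T _).2 ⟨_, rfl⟩]
        simp

instance : (isFinPres X).IsClosedUnderBinaryProducts where
  limitsOfShape_le := by
    rintro K ⟨p⟩
    let F := p.diag.obj ⟨WalkingPair.left⟩
    let G := p.diag.obj ⟨WalkingPair.right⟩
    obtain ⟨X₁, X₀, d, ε, h⟩ := exists_isPres (p.prop_diag_obj ⟨WalkingPair.left⟩)
    obtain ⟨X₁', X₀', d', ε', h'⟩ := exists_isPres (p.prop_diag_obj ⟨WalkingPair.right⟩)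
    have h2 : isFinPres X (F ⊞ G) := by
      have hext : ∀ (T : X.FullSubcategory) (z z' : (F ⊞ G).obj (op T)),
          ((biprod.fst : F ⊞ G ⟶ F).app (op T)).hom z
            = ((biprod.fst : F ⊞ G ⟶ F).app (op T)).hom z' →
          ((biprod.snd : F ⊞ G ⟶ G).app (op T)).hom z
            = ((biprod.snd : F ⊞ G ⟶ G).app (op T)).hom z' → z = z' := by
        intro T z z' h1 h2
        have htot := biprod.total (X := F) (Y := G)
        have key : ∀ y : (F ⊞ G).obj (op T), y =
            ((biprod.inl : F ⟶ F ⊞ G).app (op T)).hom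
                (((biprod.fst : F ⊞ G ⟶ F).app (op T)).hom y)
              + ((biprod.inr : G ⟶ F ⊞ G).app (op T)).hom
                (((biprod.snd : F ⊞ G ⟶ G).app (op T)).hom y) := fun y =>
          (congr_arg (fun g => (g.app (op T)).hom y) htot).symm
        rw [key z, key z', h1, h2]
      let η : (restrictedYoneda X).obj (X₀.obj ⊞ X₀'.obj) ⟶ F ⊞ G :=
        biprod.lift ((restrictedYoneda X).map biprod.fst ≫ ε)
          ((restrictedYoneda X).map biprod.snd ≫ ε')
      have hη₁ : ∀ (T : X.FullSubcategory) (t : T.obj ⟶ X₀.obj ⊞ X₀'.obj),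
          ((biprod.fst : F ⊞ G ⟶ F).app (op T)).hom ((η.app (op T)).hom t)
            = (ε.app (op T)).hom (t ≫ biprod.fst : T.obj ⟶ _) := fun T t =>
        congr_arg (fun g => (g.app (op T)).hom t)
          (show η ≫ biprod.fst = (restrictedYoneda X).map biprod.fst ≫ ε from biprod.lift_fst _ _)
      have hη₂ : ∀ (T : X.FullSubcategory) (t : T.obj ⟶ X₀.obj ⊞ X₀'.obj),
          ((biprod.snd : F ⊞ G ⟶ G).app (op T)).hom ((η.app (op T)).hom t)
            = (ε'.app (op T)).hom (t ≫ biprod.snd : T.obj ⟶ _) := fun T t =>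
        congr_arg (fun g => (g.app (op T)).hom t)
          (show η ≫ biprod.snd = (restrictedYoneda X).map biprod.snd ≫ ε' from biprod.lift_snd _ _)
      refine IsPres.isFinPres (a := biprod.map d.hom d'.hom) (ε := η)
        ⟨fun T z => ?_, fun T t => ?_⟩
      · obtain ⟨t, ht⟩ := h.surj T (((biprod.fst : F ⊞ G ⟶ F).app (op T)).hom z)
        obtain ⟨t', ht'⟩ := h'.surj T (((biprod.snd : F ⊞ G ⟶ G).app (op T)).hom z)
        refine ⟨biprod.lift t t', hext T _ _ ?_ ?_⟩
        · rw [hη₁, ← ht]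
          exact congr_arg (ε.app (op T)).hom (biprod.lift_fst _ _)
        · rw [hη₂, ← ht']
          exact congr_arg (ε'.app (op T)).hom (biprod.lift_snd _ _)
      · have h0 : (η.app (op T)).hom t = 0 ↔ (ε.app (op T)).hom (t ≫ biprod.fst : T.obj ⟶ _) = 0 ∧
            (ε'.app (op T)).hom (t ≫ biprod.snd : T.obj ⟶ _) = 0 := by
          rw [← hη₁, ← hη₂]
          refine ⟨fun h3 => by rw [h3]; simp, fun h3 => hext T _ _ ?_ ?_⟩
          · rw [h3.1, map_zero]
          · rw [h3.2, map_zero]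
        rw [h0, h.ker, h'.ker]
        constructor
        · rintro ⟨⟨s, hs⟩, s', hs'⟩
          exact ⟨biprod.lift s s', by ext <;> simp [hs, hs']⟩
        · rintro ⟨s, rfl⟩
          exact ⟨⟨s ≫ biprod.fst, by simp⟩, s ≫ biprod.snd, by simp⟩
    exact (isFinPres X).prop_of_iso (IsLimit.conePointsIsoOfNatIso (BinaryBiproduct.isLimit F G)
      p.isLimit (diagramIsoPair p.diag).symm) h2

instance : (isFinPres X).IsClosedUnderFiniteProducts := .mk'

instance : Abelian (FinPresMod X) := inferInstance

end AbelianStructure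

section FunctorE

variable {A : Type u} [Category.{v} A] [Abelian A] (X : ObjectProperty A)

/-- A choice of a presentation `(-, X₁) ⟶ (-, X₀) ⟶ F ⟶ 0`. -/
def presentation (F : FinPresMod X) : Presentation F := (nonempty_presentation F).some

/-- A lift `l : X₀(F) ⟶ X₀(G)` of a morphism `f : F ⟶ G` to the chosen presentations. -/
def IsLift {F G : FinPresMod X} (f : F ⟶ G)
    (l : (presentation X F).X₀.obj ⟶ (presentation X G).X₀.obj) : Prop :=
  (restrictedYoneda X).map l ≫ (presentation X G).ε = (presentation X F).ε ≫ f.hom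

lemma exists_isLift {F G : FinPresMod X} (f : F ⟶ G) : ∃ l, IsLift X f l := by
  obtain ⟨l, hl⟩ := exists_lift (presentation X F).ε (presentation X G).isPres f.hom
  exact ⟨l, by ext T t; exact hl T.unop t⟩

variable {X} in
lemma IsLift.app {F G : FinPresMod X} {f : F ⟶ G}
    {l : (presentation X F).X₀.obj ⟶ (presentation X G).X₀.obj} (h : IsLift X f l)
    (T : X.FullSubcategory) (t : T.obj ⟶ (presentation X F).X₀.obj) :
    ((presentation X G).ε.app (op T)).hom (t ≫ l : T.obj ⟶ _)
      = (f.hom.app (op T)).hom (((presentation X F).ε.app (op T)).hom t) :=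
  congr_arg (fun g => (g.app (op T)).hom t) h

/-- The object `e(F)`, defined by the exact sequence `X₁ ⟶ X₀ ⟶ e(F) ⟶ 0`, for a presentation
`(-, X₁) ⟶ (-, X₀) ⟶ F ⟶ 0`. -/
def eObj (F : FinPresMod X) : A := cokernel (presentation X F).d.hom

/-- The projection `X₀ ⟶ e(F)`. -/
def eπ (F : FinPresMod X) : (presentation X F).X₀.obj ⟶ eObj X F := cokernel.π _

instance (F : FinPresMod X) : Epi (eπ X F) := inferInstanceAs (Epi (cokernel.π _))

/-- The morphism `e(f)`, induced by a lift of `f` to the presentations. -/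
def eMap {F G : FinPresMod X} (f : F ⟶ G) : eObj X F ⟶ eObj X G :=
  cokernel.desc _ ((exists_isLift X f).choose ≫ eπ X G) (by
    have hl := (exists_isLift X f).choose_spec
    have h1 := hl.app _ (presentation X F).d.hom
    rw [((presentation X F).isPres.ker _ _).2 ⟨𝟙 _, Category.id_comp _⟩, map_zero,
      (presentation X G).isPres.ker] at h1
    obtain ⟨s, hs⟩ := h1
    rw [← Category.assoc, ← hs, Category.assoc]
    exact (s ≫= cokernel.condition _).trans comp_zero)

/-- `e(f)` is determined by any lift of `f` to the presentations. -/
lemma eπ_eMap {F G : FinPresMod X} {f : F ⟶ G}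
    {l : (presentation X F).X₀.obj ⟶ (presentation X G).X₀.obj} (h : IsLift X f l) :
    eπ X F ≫ eMap X f = l ≫ eπ X G := by
  refine (cokernel.π_desc _ _ _).trans ?_
  have h' := (exists_isLift X f).choose_spec
  rw [← sub_eq_zero, ← Preadditive.sub_comp]
  have h1 := h.app _ (𝟙 _)
  rw [← h'.app, eq_comm, ← sub_eq_zero, ← app_sub, (presentation X G).isPres.ker] at h1
  obtain ⟨s, hs⟩ := h1
  rw [Category.id_comp, Category.id_comp] at hs
  rw [← hs, Category.assoc]
  exact (s ≫= cokernel.condition _).trans comp_zero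

/-- The functor `e : mod X ⥤ A`, the right exact extension of the inclusion of `X` in `A`. -/
def e : FinPresMod X ⥤ A where
  obj F := eObj X F
  map f := eMap X f
  map_id F := by
    have h : IsLift X (𝟙 F) (𝟙 _) := by simp [IsLift]
    rw [← cancel_epi (eπ X F), eπ_eMap X h, Category.id_comp, Category.comp_id]
  map_comp {F G H} f g := by
    obtain ⟨l, hl⟩ := exists_isLift X f
    obtain ⟨m, hm⟩ := exists_isLift X g
    have h : IsLift X (f ≫ g) (l ≫ m) := by
      unfold IsLift at *
      rw [Functor.map_comp, Category.assoc, hm, reassoc_of% hl]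
      rfl
    rw [← cancel_epi (eπ X F), eπ_eMap X h, Category.assoc, ← eπ_eMap X hm, ← Category.assoc,
      ← eπ_eMap X hl, Category.assoc]

instance : (e X).Additive where
  map_add {F G f g} := by
    obtain ⟨l, hl⟩ := exists_isLift X f
    obtain ⟨m, hm⟩ := exists_isLift X g
    have h : IsLift X (f + g) (l + m) := by
      unfold IsLift at *
      rw [Functor.map_add, Preadditive.add_comp, hl, hm, ← Preadditive.comp_add]
      rfl
    change eMap X (f + g) = eMap X f + eMap X g
    rw [← cancel_epi (eπ X F), eπ_eMap X h, Preadditive.comp_add, eπ_eMap X hl, eπ_eMap X hm,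
      Preadditive.add_comp]

/-- For `P` in `X` projective, the elements of `F(P)` correspond to the morphisms `P ⟶ e(F)`. -/
def Corr (F : FinPresMod X) (P : X.FullSubcategory) (z : F.obj.obj (op P))
    (y : P.obj ⟶ eObj X F) : Prop :=
  ∃ t : P.obj ⟶ (presentation X F).X₀.obj,
    ((presentation X F).ε.app (op P)).hom t = z ∧ t ≫ eπ X F = y

variable {X}

lemma Corr.exists_hom {F : FinPresMod X} {P : X.FullSubcategory} (z : F.obj.obj (op P)) :
    ∃ y, Corr X F P z y := by
  obtain ⟨t, ht⟩ := (presentation X F).isPres.surj P z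
  exact ⟨_, t, ht, rfl⟩

lemma Corr.exists_elt {F : FinPresMod X} {P : X.FullSubcategory} [Projective P.obj]
    (y : P.obj ⟶ eObj X F) : ∃ z, Corr X F P z y :=
  ⟨_, Projective.factorThru y (eπ X F), rfl, Projective.factorThru_comp _ _⟩

lemma Corr.eq_zero_iff {F : FinPresMod X} {P : X.FullSubcategory} [Projective P.obj]
    {z : F.obj.obj (op P)} {y : P.obj ⟶ eObj X F} (h : Corr X F P z y) :
    z = 0 ↔ y = 0 := by
  obtain ⟨t, rfl, rfl⟩ := h
  rw [(presentation X F).isPres.ker]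
  constructor
  · rintro ⟨s, rfl⟩
    rw [Category.assoc]
    exact (s ≫= cokernel.condition _).trans comp_zero
  · intro h0
    have hex := ShortComplex.exact_cokernel (presentation X F).d.hom
    exact ⟨hex.liftFromProjective t h0, hex.liftFromProjective_comp t h0⟩

lemma Corr.map {F G : FinPresMod X} (f : F ⟶ G) {P : X.FullSubcategory}
    {z : F.obj.obj (op P)} {y : P.obj ⟶ eObj X F} (h : Corr X F P z y) :
    Corr X G P ((f.hom.app (op P)).hom z) (y ≫ eMap X f) := by
  obtain ⟨t, rfl, rfl⟩ := h
  obtain ⟨l, hl⟩ := exists_isLift X f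
  refine ⟨t ≫ l, hl.app P t, ?_⟩
  rw [Category.assoc, Category.assoc, eπ_eMap X hl]

lemma Corr.unique {F : FinPresMod X} {P : X.FullSubcategory} [Projective P.obj]
    {z : F.obj.obj (op P)} {y y' : P.obj ⟶ eObj X F} (h : Corr X F P z y)
    (h' : Corr X F P z y') : y = y' := by
  obtain ⟨t, ht, rfl⟩ := h
  obtain ⟨t', ht', rfl⟩ := h'
  have h0 : Corr X F P 0 ((t - t') ≫ eπ X F) := ⟨t - t', by rw [app_sub, ht, ht', sub_self], rfl⟩
  rw [← sub_eq_zero, ← Preadditive.sub_comp]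
  exact h0.eq_zero_iff.1 rfl

variable [ContravariantlyFinite X] [ContainsProjectives X] [EnoughProjectives A]

lemma exact_app {S : ShortComplex (FinPresMod X)} (hS : S.Exact) (P : X.FullSubcategory)
    (z : S.X₂.obj.obj (op P)) (hz : (S.g.hom.app (op P)).hom z = 0) :
    ∃ w, (S.f.hom.app (op P)).hom w = z := by
  have hk : ∀ ⦃F G : FinPresMod X⦄ (f : F ⟶ G), PreservesLimit (parallelPair f 0) (isFinPres X).ι :=
    (isFinPres X).preservesKernels_ι
  have hc : ∀ ⦃F G : FinPresMod X⦄ (f : F ⟶ G), PreservesColimit (parallelPair f 0) (isFinPres X).ι :=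
    (isFinPres X).preservesCokernels_ι
  have : (isFinPres X).ι.PreservesHomology := ⟨hk, hc⟩
  have h1 := (hS.map (isFinPres X).ι).map ((evaluation _ _).obj (op P))
  exact (ShortComplex.ab_exact_iff _).1 h1 z hz

lemma e_exact {S : ShortComplex (FinPresMod X)} (hS : S.Exact) : (S.map (e X)).Exact := by
  rw [ShortComplex.exact_iff_exact_up_to_refinements]
  intro B y hy
  change B ⟶ eObj X S.X₂ at y
  change y ≫ eMap X S.g = 0 at hy
  let P : X.FullSubcategory :=
    ⟨Projective.over B, ContainsProjectives.mem_of_projective _ inferInstance⟩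
  have : Projective P.obj := inferInstanceAs (Projective (Projective.over B))
  obtain ⟨z, hz⟩ := Corr.exists_elt (F := S.X₂) (P := P) (Projective.π B ≫ y)
  have h1 := hz.map S.g
  have h2 : (Projective.π B ≫ y) ≫ eMap X S.g = 0 := by
    rw [Category.assoc, hy, comp_zero]
  obtain ⟨w, hw⟩ := exact_app hS P z (h1.eq_zero_iff.2 h2)
  obtain ⟨x, hx⟩ := Corr.exists_hom w
  have h3 := hx.map S.f
  rw [hw] at h3
  exact ⟨P.obj, Projective.π B, inferInstance, x, hz.unique h3⟩

lemma preserves_finite_limits_colimits_e :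
    PreservesFiniteLimits (e X) ∧ PreservesFiniteColimits (e X) :=
  ((e X).exact_tfae.out 1 3).1 fun _ hS => e_exact hS

instance : PreservesFiniteLimits (e X) := preserves_finite_limits_colimits_e.1

instance : PreservesFiniteColimits (e X) := preserves_finite_limits_colimits_e.2

end FunctorE

section Bounded

open DerivedCategory.TStructure

/-- Bounded complexes, as objects of the homotopy category. -/
def isBounded (C : Type u) [Category.{v} C] [Preadditive C] :
    ObjectProperty (HomotopyCategory C (ComplexShape.up ℤ)) := fun K =>
  ∃ a b : ℤ, CochainComplex.IsStrictlyGE K.as a ∧ CochainComplex.IsStrictlyLE K.as b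

/-- The bounded homotopy category `K^b(C)`. -/
abbrev Kb (C : Type u) [Category.{v} C] [Preadditive C] := (isBounded C).FullSubcategory

universe v₁ u₁ v₂ u₂

section

variable {C : Type u₁} [Category.{v₁} C] [Preadditive C]
  {D : Type u₂} [Category.{v₂} D] [Preadditive D]

/-- The functor `K^b(C) ⥤ K^b(D)` given by termwise application of an additive functor. -/
def mapKb (F : C ⥤ D) [F.Additive] : Kb C ⥤ Kb D :=
  (isBounded D).lift ((isBounded C).ι ⋙ F.mapHomotopyCategory (ComplexShape.up ℤ)) (by
    rintro ⟨K, a, b, ha, hb⟩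
    exact ⟨a, b,
      inferInstanceAs (CochainComplex.IsStrictlyGE
        ((F.mapHomologicalComplex (ComplexShape.up ℤ)).obj K.as) a),
      inferInstanceAs (CochainComplex.IsStrictlyLE
        ((F.mapHomologicalComplex (ComplexShape.up ℤ)).obj K.as) b)⟩)

end

variable {C : Type u₁} [Category.{v₁} C] [Abelian C] [HasDerivedCategory.{w₁} C]
  {D : Type u₂} [Category.{v₂} D] [Abelian D] [HasDerivedCategory.{w₂} D]

variable (C) in
/-- The canonical functor `K^b(C) ⥤ D^b(C)`. -/
def kbToDb : Kb C ⥤ DerivedCategory.Bounded C :=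
  t.bounded.lift ((isBounded C).ι ⋙ DerivedCategory.Qh) (by
    rintro ⟨K, a, b, ha, hb⟩
    let i : DerivedCategory.Qh.obj K ≅ DerivedCategory.Q.obj K.as :=
      (DerivedCategory.quotientCompQhIso C).app K.as
    exact ⟨⟨a, K.as, i, ha⟩, ⟨b, K.as, i, hb⟩⟩)

/-- The functor `D^b(C) ⥤ D^b(D)` induced by an exact functor, acting termwise on complexes
and roofs. -/
def mapDb (F : C ⥤ D) [F.Additive] [PreservesFiniteLimits F] [PreservesFiniteColimits F] :
    DerivedCategory.Bounded C ⥤ DerivedCategory.Bounded D :=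
  t.bounded.lift (DerivedCategory.Bounded.ι ⋙ F.mapDerivedCategory) (by
    rintro ⟨K, ⟨a, L, i, ha⟩, ⟨b, L', i', hb⟩⟩
    exact ⟨⟨a, (F.mapHomologicalComplex (ComplexShape.up ℤ)).obj L,
        F.mapDerivedCategory.mapIso i ≪≫ F.mapDerivedCategoryFactors.app L, inferInstance⟩,
      ⟨b, (F.mapHomologicalComplex (ComplexShape.up ℤ)).obj L',
        F.mapDerivedCategory.mapIso i' ≪≫ F.mapDerivedCategoryFactors.app L', inferInstance⟩⟩)

end Bounded

section Adjunction

variable {A : Type u} [Category.{v} A] [Abelian A]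

variable (A) in
/-- The full subcategory of projective objects. -/
abbrev Proj := (isProjective A).FullSubcategory

variable (X : ObjectProperty A) [ContravariantlyFinite X]

/-- Every `(-, M)|_X` is finitely presented. -/
lemma isFinPres_restrictedYoneda (M : A) : isFinPres X ((restrictedYoneda X).obj M) :=
  IsPres.isFinPres (a := (0 : M ⟶ M)) (ε := 𝟙 _)
    ⟨fun _ z => ⟨z, rfl⟩, fun T t =>
      ⟨fun h => ⟨0, zero_comp.trans (show t = 0 from h).symm⟩, by
        rintro ⟨s, rfl⟩; exact comp_zero⟩⟩

/-- The functor `e_λ` on projective objects, `P ↦ (-, P)`. -/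
def eLambda : Proj A ⥤ FinPresMod X :=
  (isFinPres X).lift ((isProjective A).ι ⋙ restrictedYoneda X)
    fun P => isFinPres_restrictedYoneda X P.obj

instance : (eLambda X).Additive where
  map_add {P Q f g} := by
    ext T t
    exact Preadditive.comp_add _ _ _ _ _ _

variable (A) in
/-- The canonical functor `K^b(proj A) ⥤ D^b(A)`. -/
def kbProjToDb [HasDerivedCategory.{w₁} A] : Kb (Proj A) ⥤ DerivedCategory.Bounded A :=
  mapKb (isProjective A).ι ⋙ kbToDb A

/-- The functor `P ↦ (-, P)` from `K^b(proj A)` to `D^b(mod X)`, obtained by termwise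
application of `e_λ`. -/
def kbELambda [HasDerivedCategory.{w₂} (FinPresMod X)] :
    Kb (Proj A) ⥤ DerivedCategory.Bounded (FinPresMod X) :=
  mapKb (eLambda X) ⋙ kbToDb (FinPresMod X)

/-- The functor `D^b_e : D^b(mod X) ⥤ D^b(A)`. -/
def dbE [ContainsProjectives X] [EnoughProjectives A]
    [HasDerivedCategory.{w₁} A] [HasDerivedCategory.{w₂} (FinPresMod X)] :
    DerivedCategory.Bounded (FinPresMod X) ⥤ DerivedCategory.Bounded A :=
  mapDb (e X)

end Adjunction

section ArtinAlgebra

/-- `mod Λ`: the category of finitely generated right `Λ`-modules, for an `R`-algebra `Λ`.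
(When `Λ` is an artin `R`-algebra these are the finitely presented ones.) -/
def ModFG (R : Type w) (Λ : Type u) [CommRing R] [Ring Λ] [Algebra R Λ] : Type (u + 1) :=
  FGModuleCat.{u} Λᵐᵒᵖ

variable (R : Type w) (Λ : Type u) [CommRing R] [Ring Λ] [Algebra R Λ]

instance : Category.{u} (ModFG R Λ) := inferInstanceAs (Category.{u} (FGModuleCat.{u} Λᵐᵒᵖ))

lemma isNoetherianRing_op [IsArtinianRing R] [Module.Finite R Λ] : IsNoetherianRing Λᵐᵒᵖ :=
  isNoetherian_of_tower R (inferInstanceAs (IsNoetherian R Λᵐᵒᵖ))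

instance [IsArtinianRing R] [Module.Finite R Λ] : Abelian (ModFG R Λ) :=
  haveI := isNoetherianRing_op R Λ
  inferInstanceAs (Abelian (FGModuleCat.{u} Λᵐᵒᵖ))

/-- The projective objects of `mod Λ` are the finitely generated projective modules. -/
lemma projective_iff (S : Type u) [Ring S] [IsNoetherianRing S] (P : FGModuleCat.{u} S) :
    Projective P ↔ Module.Projective S P := by
  constructor
  · intro hP
    obtain ⟨n, f, hf⟩ := Module.Finite.exists_fin' S P
    let q : FGModuleCat.of S (Fin n → S) ⟶ P := FGModuleCat.ofHom f
    have hq : Epi q := (forget₂ (FGModuleCat S) (ModuleCat S)).epi_of_epi_map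
      ((ModuleCat.epi_iff_surjective _).2 hf)
    let s : P ⟶ FGModuleCat.of S (Fin n → S) := Projective.factorThru (𝟙 P) q
    have hs : s ≫ q = 𝟙 P := Projective.factorThru_comp _ _
    exact Module.Projective.of_split s.hom.hom f
      (congr_arg (fun g : P ⟶ P => g.hom.hom) hs)
  · intro hP
    refine ⟨fun {E Y} f g hg => ?_⟩
    have hg' : Function.Surjective g.hom.hom := (ModuleCat.epi_iff_surjective _).1
      (inferInstanceAs (Epi ((forget₂ (FGModuleCat S) (ModuleCat S)).map g)))
    obtain ⟨l, hl⟩ := Module.projective_lifting_property g.hom.hom f.hom.hom hg'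
    exact ⟨FGModuleCat.ofHom l, FGModuleCat.hom_ext hl⟩

lemma enoughProjectives_fgModuleCat (S : Type u) [Ring S] [IsNoetherianRing S] :
    EnoughProjectives (FGModuleCat.{u} S) where
  presentation M := by
    obtain ⟨n, f, hf⟩ := Module.Finite.exists_fin' S M
    let q : FGModuleCat.of S (Fin n → S) ⟶ M := FGModuleCat.ofHom f
    have hq : Epi q := (forget₂ (FGModuleCat S) (ModuleCat S)).epi_of_epi_map
      ((ModuleCat.epi_iff_surjective _).2 hf)
    exact ⟨{ p := FGModuleCat.of S (Fin n → S)
             f := q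
             projective := (projective_iff S _).2
              (inferInstanceAs (Module.Projective S (Fin n → S)))
             epi := hq }⟩

instance [IsArtinianRing R] [Module.Finite R Λ] : EnoughProjectives (ModFG R Λ) :=
  haveI := isNoetherianRing_op R Λ
  enoughProjectives_fgModuleCat Λᵐᵒᵖ

end ArtinAlgebra

end RelativeAuslander

end

open CategoryTheory RelativeAuslander

/-! The functor `e` is fully faithful on morphisms out of a representable `(-, P)` with `P`
projective, and this passes to derived categories because such representables are projective.
Applying `Hom(P, -)` to `X₁ ⟶ X₀ ⟶ e(F) ⟶ 0` keeps it exact, and since `P` lies in `X`, evaluating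
the presentation of `F` at `P` gives the same cokernel; hence `F(P) ≅ Hom(P, e(F))`. This bijection
is encoded by the relation `Corr`, which avoids committing to lifts. Together with Yoneda and the
isomorphism `P ≅ e(-, P)` (`unitIso`) it gives `Hom((-, P), F) ≅ F(P) ≅ Hom(P, e(F)) ≅ Hom(e(-, P),
e(F))`, and the composite is the action of `e` on morphisms (`e_map_bijective`).

For a bounded complex `P` of projectives, both `(-, P)` and its image under `e` are bounded above
complexes of projectives, hence K-projective. Morphisms out of them in the derived categories are
therefore homotopy classes of chain maps, where bijectivity can be checked term by term; this is
`mapDerivedCategory_map_bijective`. The adjunction isomorphism is then `f ↦ η_P ≫ D^b_e(f)`, with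
`η` the termwise unit isomorphism `unitDbIso`. In this form both naturalities are formal. -/

noncomputable section

open CategoryTheory Limits Opposite

namespace RelativeAuslander

/-! ### Yoneda, the unit `P ≅ e(-, P)`, and full faithfulness of `e` out of `(-, P)`. -/

section Unit

variable {A : Type u} [Category.{v} A] [Abelian A] {X : ObjectProperty A}

/-- Elementwise Yoneda lemma: a natural transformation from `(-, P)` is determined by its value
at the identity. -/
lemma restrictedYoneda_hom_ext {P : X.FullSubcategory}
    {F : X.FullSubcategoryᵒᵖ ⥤ AddCommGrpCat.{v}} {f g : (restrictedYoneda X).obj P.obj ⟶ F}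
    (h : (f.app (op P)).hom (𝟙 P.obj) = (g.app (op P)).hom (𝟙 P.obj)) : f = g := by
  ext T t
  have h1 := app_comp f (ObjectProperty.homMk t : T.unop ⟶ P) (𝟙 P.obj)
  have h2 := app_comp g (ObjectProperty.homMk t : T.unop ⟶ P) (𝟙 P.obj)
  rw [h, ← h2] at h1
  rw [Category.comp_id] at h1
  exact h1

/-- Elementwise Yoneda lemma: every element of `F(P)` is the value at the identity of a natural
transformation from `(-, P)`. -/
lemma exists_restrictedYoneda_hom {P : X.FullSubcategory}
    {F : X.FullSubcategoryᵒᵖ ⥤ AddCommGrpCat.{v}} [F.Additive] (z : F.obj (op P)) :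
    ∃ f : (restrictedYoneda X).obj P.obj ⟶ F, (f.app (op P)).hom (𝟙 P.obj) = z := by
  refine ⟨{ app := fun T => AddCommGrpCat.ofHom
              { toFun := fun t => (F.map (ObjectProperty.homMk t : T.unop ⟶ P).op).hom z
                map_zero' := ?_
                map_add' := fun t t' => ?_ }
            naturality := fun T T' f => ?_ }, ?_⟩
  -- The transformation sends `t` to `F(t)(z)`; additivity of `F` is what makes this a homomorphism
  -- in `t`.
  · change (F.map (0 : T.unop ⟶ P).op).hom z = 0
    rw [op_zero, F.map_zero]; rfl
  · change (F.map ((ObjectProperty.homMk t : T.unop ⟶ P)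
      + (ObjectProperty.homMk t' : T.unop ⟶ P)).op).hom z = _
    rw [op_add, F.map_add]; rfl
  · ext t
    change (F.map (f.unop ≫ (ObjectProperty.homMk t : T.unop ⟶ P)).op).hom z
      = (F.map f).hom ((F.map (ObjectProperty.homMk t : T.unop ⟶ P).op).hom z)
    rw [op_comp, F.map_comp]; rfl
  · change (F.map (𝟙 P : P ⟶ P).op).hom z = z
    rw [op_id, F.map_id]; rfl

instance (F : FinPresMod X) : F.obj.Additive := F.property.1

lemma Corr.precomp {F : FinPresMod X} {P Q : X.FullSubcategory} (p : Q ⟶ P)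
    {z : F.obj.obj (op P)} {y : P.obj ⟶ eObj X F} (h : Corr X F P z y) :
    Corr X F Q ((F.obj.map p.op).hom z) (p.hom ≫ y) := by
  obtain ⟨t, rfl, rfl⟩ := h
  exact ⟨p.hom ≫ t, app_comp _ _ _, Category.assoc _ _ _⟩

/-- With `Corr.exists_hom`, `Corr.exists_elt` and `Corr.unique`, this makes `Corr` the graph of a
bijection `F(P) ≅ Hom(P, e(F))` for projective `P`. The difference of two elements with the same
partner corresponds to `0`. -/
lemma Corr.unique_elt {F : FinPresMod X} {P : X.FullSubcategory} [Projective P.obj]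
    {z z' : F.obj.obj (op P)} {y : P.obj ⟶ eObj X F} (h : Corr X F P z y)
    (h' : Corr X F P z' y) : z = z' := by
  obtain ⟨t, rfl, ht⟩ := h
  obtain ⟨t', rfl, rfl⟩ := h'
  have h0 : Corr X F P (((presentation X F).ε.app (op P)).hom (t - t' : P.obj ⟶ _)) 0 :=
    ⟨t - t', rfl, by rw [Preadditive.sub_comp, ht, sub_self]⟩
  rw [← sub_eq_zero, ← app_sub]
  exact h0.eq_zero_iff.2 rfl

variable (X) [ContravariantlyFinite X] [ContainsProjectives X]

/-- A projective object, as an object of `X`. -/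
abbrev projInX (P : Proj A) : X.FullSubcategory :=
  ⟨P.obj, ContainsProjectives.mem_of_projective _ P.property⟩

instance (P : Proj A) : Projective (projInX X P).obj := P.property

/-- The morphism `P ⟶ e(-, P)` corresponding to the identity of `P`. -/
def unitHom (P : Proj A) : P.obj ⟶ (e X).obj ((eLambda X).obj P) :=
  (Corr.exists_hom (F := (eLambda X).obj P) (P := projInX X P) (𝟙 P.obj)).choose

lemma corr_unitHom (P : Proj A) :
    Corr X ((eLambda X).obj P) (projInX X P) (𝟙 P.obj) (unitHom X P) :=
  (Corr.exists_hom (F := (eLambda X).obj P) (P := projInX X P) (𝟙 P.obj)).choose_spec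

/-- The cokernel defining `e(-, P)` uses a chosen presentation, not the trivial one. By Yoneda its
augmentation is composition with some `s : X₀ ⟶ P`, which is a split epimorphism; `s` induces the
inverse on the cokernel. -/
instance (P : Proj A) : IsIso (unitHom X P) := by
  obtain ⟨t, ht, hy⟩ := corr_unitHom X P
  let p := presentation X ((eLambda X).obj P)
  let s : p.X₀.obj ⟶ P.obj := (p.ε.app (op p.X₀)).hom (𝟙 _)
  have hs : ∀ (T : X.FullSubcategory) (u : T.obj ⟶ p.X₀.obj),
      (p.ε.app (op T)).hom u = (u ≫ s : T.obj ⟶ P.obj) := fun T u => by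
    have h1 := app_comp p.ε (ObjectProperty.homMk u : T ⟶ p.X₀) (𝟙 _)
    rw [Category.comp_id] at h1
    exact h1
  have hts : t ≫ s = 𝟙 P.obj := (hs _ t).symm.trans ht
  have hds : p.d.hom ≫ s = 0 :=
    (hs _ _).symm.trans ((p.isPres.ker _ _).2 ⟨𝟙 _, Category.id_comp _⟩)
  let s' : eObj X ((eLambda X).obj P) ⟶ P.obj := cokernel.desc _ s hds
  have hs' : eπ X ((eLambda X).obj P) ≫ s' = s := cokernel.π_desc _ _ _
  -- Since `t ≫ s = 𝟙`, the endomorphism `s ≫ t - 𝟙` is killed by `s`. Exactness of the presentation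
  -- makes it factor through `d`, so it vanishes after projecting to `e(-, P)`.
  have h0 : (p.ε.app (op p.X₀)).hom (s ≫ t - 𝟙 _ : p.X₀.obj ⟶ p.X₀.obj) = 0 := by
    refine (hs _ _).trans ?_
    rw [Preadditive.sub_comp, Category.assoc, hts, Category.id_comp, Category.comp_id, sub_self]
    rfl
  obtain ⟨r, hr⟩ := (p.isPres.ker _ _).1 h0
  have h1 : (s ≫ t - 𝟙 _) ≫ eπ X ((eLambda X).obj P) = 0 := by
    rw [← hr, Category.assoc]
    exact (r ≫= cokernel.condition _).trans comp_zero
  rw [Preadditive.sub_comp, sub_eq_zero, Category.id_comp, Category.assoc] at h1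
  have h2 : t ≫ eπ X ((eLambda X).obj P) = unitHom X P := hy
  refine ⟨s', ?_, ?_⟩
  · exact (h2 =≫ s').symm.trans ((Category.assoc _ _ _).trans ((t ≫= hs').trans hts))
  · refine (cancel_epi (eπ X ((eLambda X).obj P))).1 ?_
    refine (Category.assoc _ _ _).symm.trans ((hs' =≫ _).trans ?_)
    refine ((s ≫= h2).symm.trans h1).trans (Category.comp_id _).symm

/-- Both sides correspond to the same element `p` of `(-, Q)(P)`, so they agree by uniqueness in
`Corr`. -/
lemma unitHom_naturality {P Q : Proj A} (p : P ⟶ Q) :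
    p.hom ≫ unitHom X Q = unitHom X P ≫ (e X).map ((eLambda X).map p) := by
  have h1 := (corr_unitHom X P).map ((eLambda X).map p)
  have h2 := (corr_unitHom X Q).precomp
    (ObjectProperty.homMk p.hom : projInX X P ⟶ projInX X Q)
  have h3 : (((eLambda X).obj Q).obj.map
      (ObjectProperty.homMk p.hom : projInX X P ⟶ projInX X Q).op).hom (𝟙 Q.obj)
        = (((eLambda X).map p).hom.app (op (projInX X P))).hom (𝟙 P.obj) :=
    (Category.comp_id p.hom).trans (Category.id_comp p.hom).symm
  rw [h3] at h2
  exact h2.unique h1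

/-- The unit isomorphism `P ≅ e(-, P)`. -/
def unitIso : (isProjective A).ι ≅ eLambda X ⋙ e X :=
  NatIso.ofComponents (fun P => asIso (unitHom X P)) (unitHom_naturality X)

lemma corr_unitHom_comp {P : Proj A} {F : FinPresMod X} (f : (eLambda X).obj P ⟶ F) :
    Corr X F (projInX X P) ((f.hom.app (op (projInX X P))).hom (𝟙 P.obj))
      (unitHom X P ≫ (e X).map f) :=
  (corr_unitHom X P).map f

/-- Yoneda identifies `f` with its value `z` at the identity, and `z` corresponds under `Corr` to
`unitHom X P ≫ e(f)`. Since `unitHom X P` is invertible, `e(f)` and `f` determine each other. -/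
lemma e_map_bijective (P : Proj A) (F : FinPresMod X) :
    Function.Bijective ((e X).map : ((eLambda X).obj P ⟶ F) → _) := by
  refine ⟨fun f g hfg => ?_, fun y => ?_⟩
  · have h1 := corr_unitHom_comp X f
    have h2 := corr_unitHom_comp X g
    rw [hfg] at h1
    ext1
    exact restrictedYoneda_hom_ext (P := projInX X P) (h1.unique_elt h2)
  · obtain ⟨z, hz⟩ := Corr.exists_elt (P := projInX X P) (unitHom X P ≫ y)
    obtain ⟨f, rfl⟩ := exists_restrictedYoneda_hom (P := projInX X P) z
    let f' : (eLambda X).obj P ⟶ F := ObjectProperty.homMk f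
    refine ⟨f', (cancel_epi (unitHom X P)).1 ?_⟩
    exact (corr_unitHom_comp X f').unique hz

/-- Exactness of `e` turns the lifting problem into one out of `e(-, P) ≅ P`, which is solvable;
bijectivity of `e` on morphisms out of `(-, P)` brings the solution back. -/
instance [EnoughProjectives A] (P : Proj A) : Projective ((eLambda X).obj P) where
  factors {F G} f g _ := by
    have : Projective ((e X).obj ((eLambda X).obj P)) :=
      Projective.of_iso (asIso (unitHom X P)) P.property
    obtain ⟨h, hh⟩ := (e_map_bijective X P F).2
      (Projective.factorThru ((e X).map f) ((e X).map g))
    refine ⟨h, (e_map_bijective X P G).1 ?_⟩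
    rw [Functor.map_comp, hh, Projective.factorThru_comp]

end Unit

/-! ### From bijectivity on terms to homotopy categories and derived categories. -/

section Complexes

universe v₁ u₁ v₂ u₂

variable {C : Type u₁} [Category.{v₁} C] {D : Type u₂} [Category.{v₂} D]

section

variable [Preadditive C] [Preadditive D] (G : C ⥤ D) [G.Additive]
  {ι : Type*} {c : ComplexShape ι} {K L : HomologicalComplex C c}

lemma mapHomologicalComplex_map_surjective
    (hG : ∀ i j, Function.Bijective (G.map : (K.X i ⟶ L.X j) → _)) :
    Function.Surjective ((G.mapHomologicalComplex c).map : (K ⟶ L) → _) := by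
  intro g
  choose f hf using fun i => (hG i i).2 (g.f i)
  refine ⟨{ f := f, comm' := fun i j _ => (hG i j).1 ?_ }, ?_⟩
  · rw [G.map_comp, G.map_comp, hf, hf]
    exact g.comm i j
  · ext i
    exact hf i

/-- The components of a homotopy are themselves morphisms out of terms of `K`, so they lift through
`G`; the homotopy identities hold because they hold after applying `G`. Components change degree,
hence the hypothesis for all pairs `i`, `j`. -/
lemma homotopy_of_mapHomologicalComplex
    (hG : ∀ i j, Function.Bijective (G.map : (K.X i ⟶ L.X j) → _)) {f g : K ⟶ L}
    (h : Homotopy ((G.mapHomologicalComplex c).map f) ((G.mapHomologicalComplex c).map g)) :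
    Nonempty (Homotopy f g) := by
  choose s hs using fun i j => (hG i j).2 (h.hom i j)
  refine ⟨{ hom := s
            zero := fun i j hij => (hG i j).1 ?_
            comm := fun i => (hG i i).1 ?_ }⟩
  · rw [hs, h.zero i j hij, G.map_zero]; rfl
  · have h1 := h.comm i
    have h2 : G.map (dNext i s) = dNext i h.hom := (G.map_comp _ _).trans (by rw [hs]; rfl)
    have h3 : G.map (prevD i s) = prevD i h.hom := (G.map_comp _ _).trans (by rw [hs]; rfl)
    rw [G.map_add, G.map_add, h2, h3]
    exact h1

lemma mapHomotopyCategory_map_bijective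
    (hG : ∀ i j, Function.Bijective (G.map : (K.X i ⟶ L.X j) → _)) :
    Function.Bijective ((G.mapHomotopyCategory c).map :
      ((HomotopyCategory.quotient C c).obj K ⟶ (HomotopyCategory.quotient C c).obj L) → _) := by
  refine ⟨fun f g hfg => ?_, fun g => ?_⟩
  · obtain ⟨f, rfl⟩ := (HomotopyCategory.quotient _ _).map_surjective f
    obtain ⟨g, rfl⟩ := (HomotopyCategory.quotient _ _).map_surjective g
    obtain ⟨h⟩ := homotopy_of_mapHomologicalComplex G hG (HomotopyCategory.homotopyOfEq _ _ hfg)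
    exact HomotopyCategory.eq_of_homotopy _ _ h
  · obtain ⟨g, rfl⟩ := (HomotopyCategory.quotient _ _).map_surjective g
    obtain ⟨f, rfl⟩ := mapHomologicalComplex_map_surjective G hG g
    exact ⟨(HomotopyCategory.quotient _ _).map f, rfl⟩

end

variable [Abelian C] [HasDerivedCategory.{w₁} C] [Abelian D] [HasDerivedCategory.{w₂} D]
  (G : C ⥤ D) [G.Additive] [PreservesFiniteLimits G] [PreservesFiniteColimits G]

/-- An exact functor which is bijective on the morphisms out of the terms of a `K`-projective
complex `K` with `K`-projective image is bijective on the morphisms out of `K` in the derived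
category. -/
lemma mapDerivedCategory_map_bijective {K : CochainComplex C ℤ} [K.IsKProjective]
    [CochainComplex.IsKProjective ((G.mapHomologicalComplex (ComplexShape.up ℤ)).obj K)]
    (hG : ∀ (i : ℤ) (M : C), Function.Bijective (G.map : (K.X i ⟶ M) → _))
    (L : DerivedCategory C) :
    Function.Bijective (G.mapDerivedCategory.map :
      (DerivedCategory.Qh.obj ((HomotopyCategory.quotient _ _).obj K) ⟶ L) → _) := by
  let K' := (HomotopyCategory.quotient _ (ComplexShape.up ℤ)).obj K
  -- Every object of the derived category is represented by a complex, so it is enough to treat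
  -- targets coming from the homotopy category.
  obtain ⟨M, ⟨i⟩⟩ : ∃ M : CochainComplex C ℤ,
      Nonempty (DerivedCategory.Qh.obj ((HomotopyCategory.quotient _ _).obj M) ≅ L) :=
    ⟨_, ⟨(DerivedCategory.quotientCompQhIso C).app _ ≪≫ DerivedCategory.Q.objObjPreimageIso L⟩⟩
  let M' := (HomotopyCategory.quotient _ (ComplexShape.up ℤ)).obj M
  have h1 : Function.Bijective (G.mapDerivedCategory.map :
      (DerivedCategory.Qh.obj K' ⟶ DerivedCategory.Qh.obj M') → _) := by
    have hQ : Function.Bijective (DerivedCategory.Qh.map : (K' ⟶ M') → _) :=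
      CochainComplex.IsKProjective.Qh_map_bijective K M'
    have hQ' := CochainComplex.IsKProjective.Qh_map_bijective
      ((G.mapHomologicalComplex (ComplexShape.up ℤ)).obj K)
      ((G.mapHomotopyCategory (ComplexShape.up ℤ)).obj M')
    have hM := mapHomotopyCategory_map_bijective (K := K) (L := M) G fun i j => hG i (M.X j)
    let τ := G.mapDerivedCategoryFactorsh
    rw [← Function.Bijective.of_comp_iff _ hQ,
      ← Function.Bijective.of_comp_iff' ((τ.app K').homCongr (τ.app M')).bijective]
    -- Up to conjugation by `τ`, applying `G` after localization is localization after applying `G`.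
    -- Three sides of this square are bijective, two of them by K-projectivity of `K` and of its
    -- image.
    have h0 : ((τ.app K').homCongr (τ.app M')) ∘
        (G.mapDerivedCategory.map ∘ DerivedCategory.Qh.map) =
          DerivedCategory.Qh.map ∘ (G.mapHomotopyCategory (ComplexShape.up ℤ)).map := by
      funext f
      exact (τ.app K').inv_comp_eq.2 (τ.hom.naturality f)
    rw [h0]
    exact hQ'.comp hM
  -- Transport from the representing complex to `L` along `i` in the source and along its image
  -- under `G` in the target.
  rw [← Function.Bijective.of_comp_iff _ ((Iso.refl _).homCongr i).bijective]
  rw [← Function.Bijective.of_comp_iff'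
    ((Iso.refl _).homCongr (G.mapDerivedCategory.mapIso i)).bijective] at h1
  convert h1 using 1
  ext f
  simp

end Complexes

/-! ### The unit on `K^b(proj A)` and the adjunction isomorphism. -/

section Adjunction

variable {A : Type u} [Category.{v} A] [Abelian A] [EnoughProjectives A]
  [HasDerivedCategory.{w₁} A] (X : ObjectProperty A) [ContravariantlyFinite X]
  [ContainsProjectives X] [HasDerivedCategory.{w₂} (FinPresMod X)]

/-- The unit isomorphism between the two functors from complexes of projective objects to the
derived category of `A`. -/
def unitDerivedIso :
    (isProjective A).ι.mapHomotopyCategory (ComplexShape.up ℤ) ⋙ DerivedCategory.Qh ≅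
      (eLambda X).mapHomotopyCategory (ComplexShape.up ℤ) ⋙ DerivedCategory.Qh ⋙
        (e X).mapDerivedCategory :=
  Functor.isoWhiskerRight
      (Functor.mapHomotopyCategoryCompIso (unitIso X).symm (ComplexShape.up ℤ)).symm
      DerivedCategory.Qh ≪≫
    Functor.associator _ _ _ ≪≫
    Functor.isoWhiskerLeft _ (e X).mapDerivedCategoryFactorsh.symm

/-- The unit isomorphism `P ≅ D^b_e(-, P)` of functors on `K^b(proj A)`. -/
def unitDbIso : kbProjToDb A ≅ kbELambda X ⋙ dbE X :=
  NatIso.ofComponents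
    (fun P => DerivedCategory.TStructure.t.bounded.isoMk ((unitDerivedIso X).app P.obj))
    fun p => by
      ext
      exact (unitDerivedIso X).hom.naturality p.hom

instance : (dbE X).Additive where
  map_add {_ _ f g} := by
    ext
    exact (e X).mapDerivedCategory.map_add (f := f.hom) (g := g.hom)

/-- Bounded derived categories are full subcategories, so the claim is the unbounded one for the
complex `(-, P)`, with `e_map_bijective` as the termwise input. -/
lemma dbE_map_bijective (P : Kb (Proj A)) (F : DerivedCategory.Bounded (FinPresMod X)) :
    Function.Bijective ((dbE X).map : ((kbELambda X).obj P ⟶ F) → _) := by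
  obtain ⟨⟨K⟩, a, b, ha, hb⟩ := P
  let K' := ((eLambda X).mapHomologicalComplex (ComplexShape.up ℤ)).obj K
  -- A complex of projectives that is bounded above is K-projective; the bound `b` serves for both
  -- `(-, P)` and its image under `e`.
  have : CochainComplex.IsStrictlyLE K b := hb
  have : CochainComplex.IsKProjective K' :=
    have (i : ℤ) : Projective (K'.X i) :=
      inferInstanceAs (Projective ((eLambda X).obj (K.X i)))
    CochainComplex.isKProjective_of_projective _ b
  have : CochainComplex.IsKProjective
      (((e X).mapHomologicalComplex (ComplexShape.up ℤ)).obj K') :=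
    have (i : ℤ) : Projective
        ((((e X).mapHomologicalComplex (ComplexShape.up ℤ)).obj K').X i) :=
      Projective.of_iso ((unitIso X).app (K.X i)) (K.X i).property
    CochainComplex.isKProjective_of_projective _ b
  have h := mapDerivedCategory_map_bijective (e X) (K := K')
    (fun i => e_map_bijective X (K.X i)) F.obj
  refine ⟨fun f g hfg => ?_, fun g => ?_⟩
  · ext
    exact h.1 (congr_arg (fun q => q.hom) hfg)
  · obtain ⟨f, hf⟩ := h.2 g.hom
    refine ⟨ObjectProperty.homMk f, ?_⟩
    ext
    exact hf

/-- The adjunction isomorphism `D^b(mod X)((-, P), F) ≅ D^b(A)(P, D^b_e(F))`. -/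
def adjunctionEquiv (P : Kb (Proj A)) (F : DerivedCategory.Bounded (FinPresMod X)) :
    ((kbELambda X).obj P ⟶ F) ≃+ ((kbProjToDb A).obj P ⟶ (dbE X).obj F) :=
  AddEquiv.mk' ((Equiv.ofBijective _ (dbE_map_bijective X P F)).trans
      ((unitDbIso X).app P).symm.homFromEquiv) fun f g => by
    simp [(dbE X).map_add]

lemma adjunctionEquiv_apply {P : Kb (Proj A)} {F : DerivedCategory.Bounded (FinPresMod X)}
    (f : (kbELambda X).obj P ⟶ F) :
    adjunctionEquiv X P F f = (unitDbIso X).hom.app P ≫ (dbE X).map f := rfl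

end Adjunction

end RelativeAuslander

end

theorem mainTheorem5 {R : Type w} [CommRing R] [IsArtinianRing R]
    {Λ : Type u} [Ring Λ] [Algebra R Λ] [Module.Finite R Λ]
    (X : ObjectProperty (ModFG R Λ)) [ContravariantlyFinite X] [ContainsProjectives X]
    [HasDerivedCategory.{w₁} (ModFG R Λ)] [HasDerivedCategory.{w₂} (FinPresMod X)] :
    ∃ φ : ∀ (P : Kb (Proj (ModFG R Λ))) (F : DerivedCategory.Bounded (FinPresMod X)),
        ((kbELambda X).obj P ⟶ F) ≃+ ((kbProjToDb (ModFG R Λ)).obj P ⟶ (dbE X).obj F),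
      (∀ {P P' : Kb (Proj (ModFG R Λ))} (F : DerivedCategory.Bounded (FinPresMod X))
          (p : P' ⟶ P) (f : (kbELambda X).obj P ⟶ F),
        φ P' F ((kbELambda X).map p ≫ f) = (kbProjToDb (ModFG R Λ)).map p ≫ φ P F f) ∧
      (∀ (P : Kb (Proj (ModFG R Λ))) {F F' : DerivedCategory.Bounded (FinPresMod X)}
          (f : (kbELambda X).obj P ⟶ F) (g : F ⟶ F'),
        φ P F' (f ≫ g) = φ P F f ≫ (dbE X).map g) := by
  refine ⟨adjunctionEquiv X, fun {P P'} F p f => ?_, fun P {F F'} f g => ?_⟩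
  -- Naturality in `P` is naturality of the unit; naturality in `F` is functoriality of `dbE`.
  · rw [adjunctionEquiv_apply, adjunctionEquiv_apply, Functor.map_comp,
      (unitDbIso X).hom.naturality_assoc]
    rfl
  · rw [adjunctionEquiv_apply, adjunctionEquiv_apply, Functor.map_comp, Category.assoc]
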